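/- Let $d, d_1, d_2$ be integers with $2 \le d_1 < d/2$ and $d_2 = d-1-d_1$, and let $C \subset \mathbb{P}^2 = \mathbb{P}^2_{\mathbb{C}}$ be the curve $f = 0$, where $$f(x,y,z) = x^d + x^{d_1}y^{d_2+1} + y^{d-1}z \in S = \mathbb{C}[x,y,z].$$ Then $f$ is homogeneous of degree $d$ and irreducible, and the following hold. 1. The curve $C$ is free with exponents $(d_1,d_2)$: one has $d_1 \le d_2$, $f$ is squarefree, and the graded $S$-module of Jacobian syzygies $\{(a,b,c)\in S^3 : a f_x + b f_y + c f_z = 0\}$ is free with a basis consisting of two homogeneous syzygies, of degrees $d_1$ and $d_2$ (the degree of a homogeneous syzygy being the common degree of $a,b,c$). 2. The curve $C$ is rational, i.e. its function field is $\mathbb{C}$-isomorphic to $\mathbb{C}(t)$. It has exactly one singular point $p$, this point is a cusp (the curve has a single branch at $p$, i.e. its local equation at $p$ is irreducible in $\mathbb{C}[[u,v]]$), and this branch has a unique Puiseux pair, namely $(d-1,d)$. Here, for a primitive parametrization $u = t^n$, $v = \sum_{k\ge n} a_k t^k$ of the branch in local coordinates $(u,v)$ at $p$, the characteristic exponents are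 defined by $e_0 = n$, $\beta_i = \min\{k : a_k \neq 0,\ e_{i-1}\nmid k\}$, $e_i = \gcd(e_{i-1},\beta_i)$ as long as $e_{i-1} > 1$, and the Puiseux pairs are the pairs $(e_{i-1}/e_i,\ \beta_i/e_i)$. -/

import Mathlib

/-! Plane projective curves over `ℂ`: freeness, function field, rationality, singular points, cusps
and Puiseux pairs.  The curve `f = 0` in `ℙ²` is given by a homogeneous `f ∈ ℂ[x, y, z]`, the
variables `x, y, z` being `X 0, X 1, X 2`. -/

namespace PlaneCurve

open MvPolynomial

/-- The module `AR(f)` of Jacobian syzygies of `f`: all triples `(a, b, c)` of polynomials with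
`a * f_x + b * f_y + c * f_z = 0`. -/
noncomputable def jacobianSyzygies (f : MvPolynomial (Fin 3) ℂ) :
    Submodule (MvPolynomial (Fin 3) ℂ) (Fin 3 → MvPolynomial (Fin 3) ℂ) :=
  LinearMap.ker (Fintype.linearCombination (MvPolynomial (Fin 3) ℂ) (fun i => pderiv i f))

theorem mem_jacobianSyzygies {f : MvPolynomial (Fin 3) ℂ} {r : Fin 3 → MvPolynomial (Fin 3) ℂ} :
    r ∈ jacobianSyzygies f ↔ r 0 * pderiv 0 f + r 1 * pderiv 1 f + r 2 * pderiv 2 f = 0 := by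
  simp [jacobianSyzygies, Fintype.linearCombination_apply, Fin.sum_univ_three]

/-- The curve `f = 0` is free with exponents `d₁ ≤ d₂`: it is reduced, and the graded module of
Jacobian syzygies is free with a homogeneous basis `r₁, r₂` of degrees `d₁, d₂` (the degree of a
syzygy is the common degree of its three components). -/
def IsFreeWithExponents (f : MvPolynomial (Fin 3) ℂ) (d₁ d₂ : ℕ) : Prop :=
  Squarefree f ∧ d₁ ≤ d₂ ∧
    ∃ b : Module.Basis (Fin 2) (MvPolynomial (Fin 3) ℂ) (jacobianSyzygies f),
      (∀ i, ((b 0 : Fin 3 → MvPolynomial (Fin 3) ℂ) i).IsHomogeneous d₁) ∧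
      (∀ i, ((b 1 : Fin 3 → MvPolynomial (Fin 3) ℂ) i).IsHomogeneous d₂)

/-- The function field `ℂ(C)` of the integral curve `C : f = 0`: all fractions `a / b`, with `a, b`
homogeneous of the same degree and `b` not divisible by `f`, in the fraction field of the
homogeneous coordinate ring `ℂ[x, y, z] / (f)`. -/
noncomputable def functionField (f : MvPolynomial (Fin 3) ℂ) [hf : (Ideal.span {f}).IsPrime] :
    IntermediateField ℂ (FractionRing (MvPolynomial (Fin 3) ℂ ⧸ Ideal.span {f})) where
  carrier := {q | ∃ (n : ℕ) (a b : MvPolynomial (Fin 3) ℂ), a.IsHomogeneous n ∧ b.IsHomogeneous n ∧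
    b ∉ Ideal.span {f} ∧
    q = algebraMap _ _ (Ideal.Quotient.mk (Ideal.span {f}) a) /
      algebraMap _ _ (Ideal.Quotient.mk (Ideal.span {f}) b)}
  mul_mem' := by
    rintro _ _ ⟨n, a, b, ha, hb, hb0, rfl⟩ ⟨m, c, e, hc, he, he0, rfl⟩
    refine ⟨n + m, a * c, b * e, ha.mul hc, hb.mul he, fun h => (hf.mem_or_mem h).elim hb0 he0, ?_⟩
    simp only [map_mul, div_mul_div_comm]
  add_mem' := by
    rintro _ _ ⟨n, a, b, ha, hb, hb0, rfl⟩ ⟨m, c, e, hc, he, he0, rfl⟩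
    have key : ∀ u : MvPolynomial (Fin 3) ℂ, u ∉ Ideal.span {f} →
        algebraMap _ (FractionRing (MvPolynomial (Fin 3) ℂ ⧸ Ideal.span {f}))
          (Ideal.Quotient.mk (Ideal.span {f}) u) ≠ 0 := by
      intro u hu h
      rw [map_eq_zero_iff _ (IsFractionRing.injective _ _), Ideal.Quotient.eq_zero_iff_mem] at h
      exact hu h
    refine ⟨n + m, a * e + b * c, b * e, (ha.mul he).add (hb.mul hc), hb.mul he,
      fun h => (hf.mem_or_mem h).elim hb0 he0, ?_⟩
    rw [div_add_div _ _ (key b hb0) (key e he0)]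
    simp only [map_mul, map_add]
  algebraMap_mem' := by
    intro r
    refine ⟨0, C r, 1, isHomogeneous_C _ _, isHomogeneous_one _ _,
      fun h => hf.ne_top ((Ideal.eq_top_iff_one _).2 h), ?_⟩
    simp only [map_one, div_one]
    rfl
  inv_mem' := by
    rintro _ ⟨n, a, b, ha, hb, hb0, rfl⟩
    by_cases ha0 : a ∈ Ideal.span {f}
    · refine ⟨n, a, b, ha, hb, hb0, ?_⟩
      rw [Ideal.Quotient.eq_zero_iff_mem.2 ha0]
      simp
    · exact ⟨n, b, a, hb, ha, ha0, inv_div _ _⟩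

/-- The curve `f = 0` is rational: it is integral and birational to the projective line, that is,
its function field is `ℂ`-isomorphic to `ℂ(t)`. -/
def IsRational (f : MvPolynomial (Fin 3) ℂ) : Prop :=
  ∃ _ : (Ideal.span {f}).IsPrime, Nonempty (functionField f ≃ₐ[ℂ] RatFunc ℂ)

/-- The point `p` of `ℙ²` is a singular point of `f = 0`. -/
def IsSingularPoint (f : MvPolynomial (Fin 3) ℂ) (p : Projectivization ℂ (Fin 3 → ℂ)) : Prop :=
  eval p.rep f = 0 ∧ ∀ i, eval p.rep (pderiv i f) = 0

/-- `(w, e₁, e₂)` is a basis of `ℂ³` whose first vector represents the point `p`.  Then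
`(u, v) ↦ [w + u e₁ + v e₂]` is an affine chart of `ℙ²` centred at `p`. -/
def IsFrameAt (p : Projectivization ℂ (Fin 3 → ℂ)) (w e₁ e₂ : Fin 3 → ℂ) : Prop :=
  LinearIndependent ℂ ![w, e₁, e₂] ∧ ∃ hw : w ≠ 0, Projectivization.mk ℂ w hw = p

/-- The equation `f (w + u e₁ + v e₂)` of the curve in the chart given by `(w, e₁, e₂)`, with
`u = X 0` and `v = X 1`. -/
noncomputable def localEquation (f : MvPolynomial (Fin 3) ℂ) (w e₁ e₂ : Fin 3 → ℂ) :
    MvPolynomial (Fin 2) ℂ :=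
  aeval (fun i => C (w i) + C (e₁ i) * X 0 + C (e₂ i) * X 1) f

/-- The point `p` is a cusp of `f = 0`: a singular point at which the curve has exactly one branch,
i.e. its local equation is irreducible in `ℂ⟦u, v⟧`. -/
def IsCusp (f : MvPolynomial (Fin 3) ℂ) (p : Projectivization ℂ (Fin 3 → ℂ)) : Prop :=
  IsSingularPoint f p ∧ ∃ w e₁ e₂ : Fin 3 → ℂ, IsFrameAt p w e₁ e₂ ∧
    Irreducible (localEquation f w e₁ e₂ : MvPowerSeries (Fin 2) ℂ)

open Classical in
/-- The greatest common divisor of `n` and of all exponents `j < k` that occur in `a`. -/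
noncomputable def gcdBelow (n : ℕ) (a : PowerSeries ℂ) (k : ℕ) : ℕ :=
  Nat.gcd n (((Finset.range k).filter (fun j => PowerSeries.coeff j a ≠ 0)).gcd id)

/-- The Puiseux pairs of `u = t ^ n, v = a(t)`.  The characteristic exponents `β₁ < β₂ < ⋯` are the
exponents of `a` that are not divisible by `gcdBelow`; so `β₁` is the first exponent not divisible
by `e₀ = n`, and `βᵢ` the first one not divisible by `eᵢ₋₁ = gcd (n, β₁, …, βᵢ₋₁)`.  The `i`-th
Puiseux pair is `(eᵢ₋₁ / eᵢ, βᵢ / eᵢ)`. -/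
def puiseuxPairs (n : ℕ) (a : PowerSeries ℂ) : Set (ℕ × ℕ) :=
  {P | ∃ k, PowerSeries.coeff k a ≠ 0 ∧ ¬ gcdBelow n a k ∣ k ∧
    P = (gcdBelow n a k / Nat.gcd (gcdBelow n a k) k, k / Nat.gcd (gcdBelow n a k) k)}

/-- The curve `f = 0` has a single branch at `p`, and `S` is the set of Puiseux pairs of that
branch: in suitable affine coordinates centred at `p` the local equation is irreducible in
`ℂ⟦u, v⟧`, and the branch has a primitive Puiseux parametrization `u = t ^ n, v = a(t)`, where
`ord a ≥ n` (so `n` is the multiplicity of the branch), with Puiseux pairs `S`. -/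
def HasPuiseuxPairs (f : MvPolynomial (Fin 3) ℂ) (p : Projectivization ℂ (Fin 3 → ℂ)) (S : Set (ℕ × ℕ)) : Prop :=
  ∃ w e₁ e₂ : Fin 3 → ℂ, IsFrameAt p w e₁ e₂ ∧
    Irreducible (localEquation f w e₁ e₂ : MvPowerSeries (Fin 2) ℂ) ∧
    ∃ (n : ℕ) (a : PowerSeries ℂ), 0 < n ∧ (n : ℕ∞) ≤ a.order ∧
      (∀ k, k ∣ n → (∀ j, PowerSeries.coeff j a ≠ 0 → k ∣ j) → k = 1) ∧
      aeval ![PowerSeries.X ^ n, a] (localEquation f w e₁ e₂) = 0 ∧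
      puiseuxPairs n a = S

/-- The polynomial `x ^ d + x ^ d₁ * y ^ (d₂ + 1) + y ^ (d - 1) * z`. -/
noncomputable def curvePoly (d d₁ d₂ : ℕ) : MvPolynomial (Fin 3) ℂ :=
  X 0 ^ d + X 0 ^ d₁ * X 1 ^ (d₂ + 1) + X 1 ^ (d - 1) * X 2

end PlaneCurve

namespace PlaneCurve

open MvPolynomial

/-! The polynomial `f` is linear in `z`, with leading coefficient `y^(d-1)` prime to the rest. This
gives irreducibility, and the parametrization `(t : 1 : -(t^d + t^d₁))`, whence the function field
is `ℂ(x/y)`. Freeness comes from divisibility by powers of `y`: `f_y` and `f_z` are multiples of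
`y^d₂`, while `f_x` is prime to `y`. So `y^d₂` divides the first entry of every syzygy. Subtracting
a multiple of `highSyzygy` kills that entry, and what remains is a multiple of `lowSyzygy`
(`exists_eq_of_mem_jacobianSyzygies`). At `(0 : 0 : 1)` the local equation is `u^d + u^d₁ v^(d₂+1) +
v^(d-1)`. With weights `d-1, d` for `u, v`, the middle term lies strictly above the Newton segment
joining the other two. Since `d-1` and `d` are coprime, the equation is irreducible
(`irreducible_of_newtonPolygon`), and Hensel's lemma gives a branch `u = t^(d-1)`, `v = t^d b(t)`
with `b(0) ≠ 0`, so the only Puiseux pair is `(d-1, d)`. -/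

theorem not_X_one_dvd_of_eval_ne_zero {g : MvPolynomial (Fin 3) ℂ}
    (h : eval ![1, 0, 0] g ≠ 0) : ¬ X 1 ∣ g := by
  rintro ⟨q, rfl⟩
  simp at h

theorem prime_X_one : Prime (X 1 : MvPolynomial (Fin 3) ℂ) := X_prime

/-! ### Irreducibility and singular points -/

theorem isHomogeneous_curvePoly {d d₁ d₂ : ℕ} (hd : d = d₁ + d₂ + 1) :
    (curvePoly d d₁ d₂).IsHomogeneous d := by
  have hX := fun i : Fin 3 => isHomogeneous_X ℂ i
  refine IsHomogeneous.add (IsHomogeneous.add ?_ ?_) ?_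
  · simpa using (hX 0).pow d
  · convert ((hX 0).pow d₁).mul ((hX 1).pow (d₂ + 1)) using 1
    omega
  · convert ((hX 1).pow (d - 1)).mul (hX 2) using 1
    omega

theorem irreducible_curvePoly {d d₁ d₂ : ℕ} (hd : d = d₁ + d₂ + 1) :
    Irreducible (curvePoly d d₁ d₂) := by
  have hd0 : d ≠ 0 := by omega
  rw [curvePoly, add_comm]
  refine irreducible_mul_X_add _ _ 2 (pow_ne_zero _ (X_ne_zero _)) ?_ ?_ ?_
  · intro h
    simpa using vars_pow _ _ h
  · intro h
    rcases Finset.mem_union.1 (vars_add_subset _ _ h) with h | h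
    · simpa using vars_pow _ _ h
    · rcases Finset.mem_union.1 (vars_mul _ _ h) with h | h <;> simpa using vars_pow _ _ h
  · refine IsRelPrime.pow_left ?_
    rw [prime_X_one.irreducible.isRelPrime_iff_not_dvd]
    exact not_X_one_dvd_of_eval_ne_zero (by simp)

theorem pderiv_curvePoly (d d₁ d₂ : ℕ) :
    pderiv 0 (curvePoly d d₁ d₂) =
        (d : MvPolynomial (Fin 3) ℂ) * X 0 ^ (d - 1) +
          (d₁ : MvPolynomial (Fin 3) ℂ) * (X 0 ^ (d₁ - 1) * X 1 ^ (d₂ + 1)) ∧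
      pderiv 1 (curvePoly d d₁ d₂) =
        ((d₂ + 1 : ℕ) : MvPolynomial (Fin 3) ℂ) * (X 0 ^ d₁ * X 1 ^ d₂) +
          ((d - 1 : ℕ) : MvPolynomial (Fin 3) ℂ) * (X 1 ^ (d - 1 - 1) * X 2) ∧
      pderiv 2 (curvePoly d d₁ d₂) = X 1 ^ (d - 1) := by
  refine ⟨?_, ?_, ?_⟩ <;>
  · simp [curvePoly, pderiv_X, Derivation.leibniz, Derivation.leibniz_pow]
    try ring

theorem isSingularPoint_curvePoly_iff {d d₁ d₂ : ℕ} (hd : d = d₁ + d₂ + 1) (h₁ : 2 ≤ d₁)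
    (h₂ : d₁ ≤ d₂) (q : Projectivization ℂ (Fin 3 → ℂ)) :
    IsSingularPoint (curvePoly d d₁ d₂) q ↔ q.rep 0 = 0 ∧ q.rep 1 = 0 := by
  obtain ⟨e0, e1, e2⟩ := pderiv_curvePoly d d₁ d₂
  simp only [IsSingularPoint, Fin.forall_fin_succ, Fin.succ_zero_eq_one, Fin.succ_one_eq_two,
    e0, e1, e2, IsEmpty.forall_iff, and_true]
  have hd0 : d ≠ 0 := by omega
  have hd1 : d - 1 ≠ 0 := by omega
  have hd2 : d - 1 - 1 ≠ 0 := by omega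
  have hd3 : d₁ - 1 ≠ 0 := by omega
  have hd4 : d₂ ≠ 0 := by omega
  constructor
  -- `f_z = y^(d-1)` forces `y = 0`, and then `f = x^d` forces `x = 0`.
  · rintro ⟨h, -, -, h1⟩
    have hy : q.rep 1 = 0 := by simpa [hd1] using h1
    refine ⟨?_, hy⟩
    simpa [curvePoly, hy, hd1, hd0] using h
  · rintro ⟨hx, hy⟩
    simp [curvePoly, hx, hy, hd0, hd1, hd2, hd3, hd4]

theorem rep_eq_zero_iff_eq_mk (q : Projectivization ℂ (Fin 3 → ℂ)) (h : ![(0 : ℂ), 0, 1] ≠ 0) :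
    (q.rep 0 = 0 ∧ q.rep 1 = 0) ↔ q = Projectivization.mk ℂ ![(0 : ℂ), 0, 1] h := by
  constructor
  · rintro ⟨hx, hy⟩
    rw [← q.mk_rep, Projectivization.mk_eq_mk_iff']
    refine ⟨q.rep 2, ?_⟩
    ext i
    fin_cases i <;> simp [hx, hy]
  · rintro rfl
    obtain ⟨a, ha⟩ := Projectivization.exists_smul_eq_mk_rep ℂ ![(0 : ℂ), 0, 1] h
    rw [← ha]
    simp

/-! ### Freeness of the Jacobian syzygies -/

/-- The syzygy of degree `d₁`. -/
noncomputable def lowSyzygy (d d₁ d₂ : ℕ) : Fin 3 → MvPolynomial (Fin 3) ℂ :=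
  ![0, X 1 ^ d₁, -(C ((d₂ : ℂ) + 1) * X 0 ^ d₁ + C ((d : ℂ) - 1) * (X 1 ^ (d₁ - 1) * X 2))]

/-- The syzygy of degree `d₂`. -/
noncomputable def highSyzygy (d d₁ d₂ : ℕ) : Fin 3 → MvPolynomial (Fin 3) ℂ :=
  ![X 1 ^ d₂,
    C (-(d : ℂ) / (d₂ + 1)) * X 0 ^ d₂ +
      C ((d : ℂ) * (d - 1) / (d₂ + 1) ^ 2) * (X 0 ^ (d₂ - d₁) * X 1 ^ (d₁ - 1) * X 2),
    C (-(d₁ : ℂ)) * (X 0 ^ (d₁ - 1) * X 1 ^ (d₂ + 1 - d₁)) +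
      C (-((d : ℂ) * (d - 1) ^ 2 / (d₂ + 1) ^ 2)) *
        (X 0 ^ (d₂ - d₁) * X 1 ^ (d₁ - 2) * X 2 ^ 2)]

variable {d d₁ d₂ : ℕ}

theorem lowSyzygy_mem (hd : d = d₁ + d₂ + 1) (h₁ : 2 ≤ d₁) (h₂ : d₁ ≤ d₂) :
    lowSyzygy d d₁ d₂ ∈ jacobianSyzygies (curvePoly d d₁ d₂) := by
  obtain ⟨m, rfl⟩ := Nat.exists_eq_add_of_le h₁
  obtain ⟨k, rfl⟩ := Nat.exists_eq_add_of_le h₂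
  obtain ⟨e0, e1, e2⟩ := pderiv_curvePoly d (2 + m) (2 + m + k)
  rw [mem_jacobianSyzygies, e0, e1, e2]
  subst hd
  simp only [lowSyzygy, Matrix.cons_val]
  have a1 : 2 + m + (2 + m + k) + 1 - 1 = 2 * m + k + 4 := by omega
  have a2 : 2 + m - 1 = m + 1 := by omega
  rw [a1, a2]
  simp only [show 2 * m + k + 4 - 1 = 2 * m + k + 3 by omega]
  simp only [map_add, map_sub, map_natCast, map_one]
  push_cast
  ring

/-- In `y^d₂ f_x + b f_y`, the two terms of `b` successively cancel the monomials `x^(d-1) y^d₂` and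
`x^d₂ y^(d-2) z`. The remaining monomials are divisible by `f_z = y^(d-1)` because `d₁ ≤ d₂` and `2
≤ d₁`; the third entry absorbs them. -/
theorem highSyzygy_mem (hd : d = d₁ + d₂ + 1) (h₁ : 2 ≤ d₁) (h₂ : d₁ ≤ d₂) :
    highSyzygy d d₁ d₂ ∈ jacobianSyzygies (curvePoly d d₁ d₂) := by
  obtain ⟨m, rfl⟩ := Nat.exists_eq_add_of_le h₁
  obtain ⟨k, rfl⟩ := Nat.exists_eq_add_of_le h₂
  obtain ⟨e0, e1, e2⟩ := pderiv_curvePoly d (2 + m) (2 + m + k)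
  rw [mem_jacobianSyzygies, e0, e1, e2]
  subst hd
  simp only [highSyzygy, Matrix.cons_val]
  have hc : ((2 + m + k : ℕ) : ℂ) + 1 ≠ 0 := Nat.cast_add_one_ne_zero _
  have hC : (C ((2 + m + k : ℕ) : ℂ) + 1 : MvPolynomial (Fin 3) ℂ) *
      C ((((2 + m + k : ℕ) : ℂ) + 1)⁻¹) = 1 := by
    rw [← C_1, ← C_add, ← C_mul, mul_inv_cancel₀ hc]
  simp only [div_eq_mul_inv, ← inv_pow, map_mul, map_neg, map_pow]
  generalize (C ((((2 + m + k : ℕ) : ℂ) + 1)⁻¹) : MvPolynomial (Fin 3) ℂ) = I at *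
  have a1 : 2 + m + (2 + m + k) + 1 - 1 = 2 * m + k + 4 := by omega
  have a2 : 2 + m - 1 = m + 1 := by omega
  have a3 : 2 + m + k - (2 + m) = k := by omega
  have a4 : 2 + m + k + 1 - (2 + m) = k + 1 := by omega
  have a5 : 2 + m - 2 = m := by omega
  rw [a1, a2, a3, a4, a5]
  simp only [show 2 * m + k + 4 - 1 = 2 * m + k + 3 by omega]
  simp only [map_sub, map_natCast, map_one] at hC ⊢
  push_cast at hC ⊢
  have hC' : I * (2 + m + k + 1) = 1 := by linear_combination hC
  -- `I` is the inverse of `d₂ + 1`; it enters exactly in the two cancellations, at `x^(d-1) y^d₂`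
  -- and `x^d₂ y^(d-2) z`.
  linear_combination (-(4 + 2 * m + k + 1) * (X 0 ^ (2 * m + k + 4) * X 1 ^ (2 + m + k)) +
    (4 + 2 * m + k + 1) * (4 + 2 * m + k) * I *
      (X 0 ^ (2 + m + k) * X 1 ^ (2 * m + k + 3) * X 2)) * hC'

theorem isHomogeneous_lowSyzygy (h₁ : 2 ≤ d₁) (i : Fin 3) :
    (lowSyzygy d d₁ d₂ i).IsHomogeneous d₁ := by
  have hX := fun i : Fin 3 => isHomogeneous_X ℂ i
  fin_cases i
  · exact isHomogeneous_zero _ _ _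
  · simpa [lowSyzygy] using (hX 1).pow d₁
  · refine IsHomogeneous.neg (IsHomogeneous.add ?_ ?_)
    · simpa using ((hX 0).pow d₁).C_mul ((d₂ : ℂ) + 1)
    · have h := ((hX 1).pow (d₁ - 1)).mul (hX 2)
      rw [one_mul, Nat.sub_add_cancel (by omega)] at h
      exact h.C_mul _

theorem isHomogeneous_highSyzygy (h₁ : 2 ≤ d₁) (h₂ : d₁ ≤ d₂) (i : Fin 3) :
    (highSyzygy d d₁ d₂ i).IsHomogeneous d₂ := by
  have hX := fun i : Fin 3 => isHomogeneous_X ℂ i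
  fin_cases i
  · simpa [highSyzygy] using (hX 1).pow d₂
  · refine IsHomogeneous.add (IsHomogeneous.C_mul ?_ _) (IsHomogeneous.C_mul ?_ _)
    · simpa using (hX 0).pow d₂
    · convert (((hX 0).pow (d₂ - d₁)).mul ((hX 1).pow (d₁ - 1))).mul (hX 2) using 1
      omega
  · refine IsHomogeneous.add (IsHomogeneous.C_mul ?_ _) (IsHomogeneous.C_mul ?_ _)
    · convert ((hX 0).pow (d₁ - 1)).mul ((hX 1).pow (d₂ + 1 - d₁)) using 1
      omega
    · convert (((hX 0).pow (d₂ - d₁)).mul ((hX 1).pow (d₁ - 2))).mul ((hX 2).pow 2) using 1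
      omega

theorem X_one_pow_dvd_of_dvd_mul {n : ℕ} {a g : MvPolynomial (Fin 3) ℂ}
    (h : eval ![1, 0, 0] g ≠ 0) (hag : X 1 ^ n ∣ a * g) : X 1 ^ n ∣ a :=
  prime_X_one.pow_dvd_of_dvd_mul_right n (not_X_one_dvd_of_eval_ne_zero h) hag

theorem exists_eq_of_mem_jacobianSyzygies (hd : d = d₁ + d₂ + 1) (h₁ : 2 ≤ d₁) (h₂ : d₁ ≤ d₂)
    {r : Fin 3 → MvPolynomial (Fin 3) ℂ} (hr : r ∈ jacobianSyzygies (curvePoly d d₁ d₂)) :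
    ∃ p q : MvPolynomial (Fin 3) ℂ, r = p • lowSyzygy d d₁ d₂ + q • highSyzygy d d₁ d₂ := by
  obtain ⟨e0, e1, e2⟩ := pderiv_curvePoly d d₁ d₂
  have hd1 : d₁ - 1 ≠ 0 := by omega
  have hd2 : d₂ ≠ 0 := by omega
  have hd0 : (d : ℂ) ≠ 0 := by exact_mod_cast (show d ≠ 0 by omega)
  obtain ⟨q, hq⟩ : X 1 ^ d₂ ∣ r 0 := by
    refine X_one_pow_dvd_of_dvd_mul (g := pderiv 0 (curvePoly d d₁ d₂)) ?_ ?_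
    · rw [e0]
      simp [hd0]
    · have h := mem_jacobianSyzygies.1 hr
      rw [add_assoc, add_eq_zero_iff_eq_neg] at h
      rw [h, e1, e2, dvd_neg]
      refine dvd_add (dvd_mul_of_dvd_right (dvd_add ?_ ?_) _) (dvd_mul_of_dvd_right ?_ _)
      · exact ⟨_, by rw [← mul_assoc, mul_comm]⟩
      · exact dvd_mul_of_dvd_right (dvd_mul_of_dvd_left (pow_dvd_pow _ (by omega)) _) _
      · exact pow_dvd_pow _ (by omega)
  obtain ⟨s, hs⟩ : ∃ s, s = r - q • highSyzygy d d₁ d₂ := ⟨_, rfl⟩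
  have hs0 : s 0 = 0 := by
    rw [hs, Pi.sub_apply, Pi.smul_apply, hq, highSyzygy, Matrix.cons_val_zero, smul_eq_mul]
    ring
  have hsm : s ∈ jacobianSyzygies (curvePoly d d₁ d₂) :=
    hs ▸ Submodule.sub_mem _ hr (Submodule.smul_mem _ _ (highSyzygy_mem hd h₁ h₂))
  -- `f_y = y^d₂ A` and `f_z = y^d₂ y^d₁`, so `y^d₂` cancels from the relation; `A` is again prime
  -- to `y`.
  obtain ⟨A, hA⟩ : ∃ A : MvPolynomial (Fin 3) ℂ,
    A = C ((d₂ : ℂ) + 1) * X 0 ^ d₁ + C ((d : ℂ) - 1) * (X 1 ^ (d₁ - 1) * X 2) := ⟨_, rfl⟩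
  have hsA : s 1 * A + s 2 * X 1 ^ d₁ = 0 := by
    have h := mem_jacobianSyzygies.1 hsm
    rw [hs0, zero_mul, zero_add, e1, e2] at h
    refine (mul_eq_zero.1 ?_).resolve_left (pow_ne_zero d₂ (X_ne_zero (R := ℂ) (1 : Fin 3)))
    rw [← h, hA]
    obtain ⟨m, rfl⟩ := Nat.exists_eq_add_of_le h₁
    subst hd
    have a1 : 2 + m + d₂ + 1 - 1 = 2 + m + d₂ := by omega
    have a2 : 2 + m - 1 = m + 1 := by omega
    have a3 : 2 + m + d₂ - 1 = m + d₂ + 1 := by omega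
    rw [a1, a2, a3]
    simp only [map_add, map_sub, map_natCast, map_one]
    push_cast
    ring
  obtain ⟨p, hp⟩ : X 1 ^ d₁ ∣ s 1 := by
    refine X_one_pow_dvd_of_dvd_mul (g := A) ?_ ?_
    · simpa [hA] using Nat.cast_add_one_ne_zero (R := ℂ) d₂
    · exact ⟨-s 2, by linear_combination hsA⟩
  have hs2 : s 2 = -(p * A) := by
    refine mul_left_cancel₀ (pow_ne_zero d₁ (X_ne_zero (R := ℂ) (1 : Fin 3))) ?_
    rw [hp] at hsA
    linear_combination hsA
  refine ⟨p, q, ?_⟩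
  rw [← sub_eq_iff_eq_add, ← hs]
  ext1 i
  fin_cases i
  · simpa [lowSyzygy] using hs0
  · simpa [lowSyzygy, mul_comm] using hp
  · have hA2 : lowSyzygy d d₁ d₂ 2 = -A := by rw [hA]; rfl
    simpa [hA2] using hs2

theorem isFreeWithExponents_curvePoly (hd : d = d₁ + d₂ + 1) (h₁ : 2 ≤ d₁) (h₂ : d₁ ≤ d₂) :
    IsFreeWithExponents (curvePoly d d₁ d₂) d₁ d₂ := by
  refine ⟨(irreducible_curvePoly hd).squarefree, h₂, ?_⟩
  obtain ⟨v, hv⟩ : ∃ v : Fin 2 → jacobianSyzygies (curvePoly d d₁ d₂),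
      v = ![⟨_, lowSyzygy_mem hd h₁ h₂⟩, ⟨_, highSyzygy_mem hd h₁ h₂⟩] := ⟨_, rfl⟩
  have hli : LinearIndependent (MvPolynomial (Fin 3) ℂ) v := by
    rw [hv, LinearIndependent.pair_iff]
    intro p q h
    have h' := congrArg Subtype.val h
    have hq : q = 0 := by simpa [lowSyzygy, highSyzygy] using congrFun h' 0
    have hp : p = 0 := by simpa [hq, lowSyzygy] using congrFun h' 1
    exact ⟨hp, hq⟩
  have hsp : ⊤ ≤ Submodule.span (MvPolynomial (Fin 3) ℂ) (Set.range v) := by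
    rintro ⟨r, hr⟩ -
    obtain ⟨p, q, rfl⟩ := exists_eq_of_mem_jacobianSyzygies hd h₁ h₂ hr
    rw [hv, Matrix.range_cons, Matrix.range_cons, Matrix.range_empty, Set.union_empty,
      Set.singleton_union, Submodule.mem_span_pair]
    exact ⟨p, q, rfl⟩
  refine ⟨Module.Basis.mk hli hsp, ?_, ?_⟩
  · simpa [hv] using isHomogeneous_lowSyzygy h₁
  · simpa [hv] using isHomogeneous_highSyzygy h₁ h₂

/-! ### Rationality -/

theorem aeval_mul_of_isHomogeneous {A : Type*} [CommRing A] [Algebra ℂ A] {n : ℕ}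
    {φ : MvPolynomial (Fin 3) ℂ} (hφ : φ.IsHomogeneous n) (c : A) (v : Fin 3 → A) :
    aeval (fun i => c * v i) φ = c ^ n * aeval v φ := by
  rw [aeval_def, aeval_def, eval₂_eq', eval₂_eq', Finset.mul_sum]
  refine Finset.sum_congr rfl fun m hm => ?_
  have hdeg : ∑ i, m i = n := by
    rw [← Finsupp.degree_eq_sum, Finsupp.degree_eq_weight_one]
    exact hφ (mem_support_iff.1 hm)
  simp_rw [mul_pow, Finset.prod_mul_distrib, Finset.prod_pow_eq_pow_sum, hdeg]
  ring

theorem aeval_mem_of_forall_mem {A : Type*} [CommRing A] [Algebra ℂ A] (B : Subalgebra ℂ A)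
    (v : Fin 3 → A) (hv : ∀ i, v i ∈ B) (φ : MvPolynomial (Fin 3) ℂ) : aeval v φ ∈ B := by
  have h : aeval v φ ∈ (aeval v : MvPolynomial (Fin 3) ℂ →ₐ[ℂ] A).range := ⟨φ, rfl⟩
  rw [← Algebra.adjoin_range_eq_range_aeval] at h
  exact Algebra.adjoin_le (by rintro _ ⟨i, rfl⟩; exact hv i) h

theorem transcendental_of_forall_ne_algebraMap {k K : Type*} [Field k] [IsAlgClosed k] [Field K]
    [Algebra k K] {θ : K} (h : ∀ c, θ ≠ algebraMap k K c) : Transcendental k θ := by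
  intro hθ
  have := IntermediateField.isAlgebraic_adjoin_simple (K := k) hθ.isIntegral
  have hmem := IntermediateField.mem_adjoin_simple_self k θ
  rw [IntermediateField.eq_bot_of_isAlgClosed_of_isAlgebraic (IntermediateField.adjoin k {θ}),
    IntermediateField.mem_bot] at hmem
  obtain ⟨c, hc⟩ := hmem
  exact h c hc.symm

/-- The affine parametrization `t ↦ (t, 1, -(t ^ d + t ^ d₁))` vanishes on the curve. -/
theorem aeval_parametrization_curvePoly :
    aeval ![Polynomial.X, 1, -(Polynomial.X ^ d + Polynomial.X ^ d₁)] (curvePoly d d₁ d₂) =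
      (0 : Polynomial ℂ) := by
  simp [curvePoly]

theorem div_eq_of_map_curvePoly_eq_zero {K : Type*} [Field K] [Algebra ℂ K]
    (hd : d = d₁ + d₂ + 1) (π : MvPolynomial (Fin 3) ℂ →ₐ[ℂ] K) (hy : π (X 1) ≠ 0)
    (h0 : π (curvePoly d d₁ d₂) = 0) :
    π (X 2) / π (X 1) = -((π (X 0) / π (X 1)) ^ d + (π (X 0) / π (X 1)) ^ d₁) := by
  subst hd
  simp only [curvePoly, map_add, map_mul, map_pow] at h0
  rw [Nat.add_sub_cancel] at h0
  rw [div_pow, div_pow, div_add_div _ _ (pow_ne_zero _ hy) (pow_ne_zero _ hy), ← neg_div,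
    div_eq_div_iff hy (mul_ne_zero (pow_ne_zero _ hy) (pow_ne_zero _ hy))]
  linear_combination π (X 1) ^ (d₁ + 1) * h0

/-- Dehomogenize by `y`: in a quotient of two forms of degree `n` the factors `y^n` cancel, and
`z/y` is a polynomial in `x/y` by the equation of the curve. -/
theorem functionField_curvePoly_eq_adjoin [(Ideal.span {curvePoly d d₁ d₂}).IsPrime]
    (π : MvPolynomial (Fin 3) ℂ →ₐ[ℂ]
      FractionRing (MvPolynomial (Fin 3) ℂ ⧸ Ideal.span {curvePoly d d₁ d₂}))
    (hπ : ∀ a, π a = algebraMap _ _ (Ideal.Quotient.mk (Ideal.span {curvePoly d d₁ d₂}) a))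
    (hd : d = d₁ + d₂ + 1) (hX : X 1 ∉ Ideal.span {curvePoly d d₁ d₂}) (hy : π (X 1) ≠ 0) :
    functionField (curvePoly d d₁ d₂) = IntermediateField.adjoin ℂ {π (X 0) / π (X 1)} := by
  have hθ := IntermediateField.mem_adjoin_simple_self ℂ (π (X 0) / π (X 1))
  apply le_antisymm
  · rintro _ ⟨n, a, b, ha, hb, -, rfl⟩
    have hv : ∀ i, ![π (X 0) / π (X 1), 1, π (X 2) / π (X 1)] i ∈
        (IntermediateField.adjoin ℂ {π (X 0) / π (X 1)}).toSubalgebra := by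
      have hz : π (X 2) / π (X 1) = -((π (X 0) / π (X 1)) ^ d + (π (X 0) / π (X 1)) ^ d₁) := by
        refine div_eq_of_map_curvePoly_eq_zero hd π hy ?_
        rw [hπ, Ideal.Quotient.eq_zero_iff_mem.2 (Ideal.mem_span_singleton_self _), map_zero]
      intro i
      fin_cases i
      · exact hθ
      · exact one_mem _
      · change π (X 2) / π (X 1) ∈ IntermediateField.adjoin ℂ {π (X 0) / π (X 1)}
        rw [hz]
        exact neg_mem (add_mem (pow_mem hθ _) (pow_mem hθ _))
    have key : ∀ {u : MvPolynomial (Fin 3) ℂ}, u.IsHomogeneous n →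
        π u = π (X 1) ^ n * aeval ![π (X 0) / π (X 1), 1, π (X 2) / π (X 1)] u := by
      intro u hu
      rw [← aeval_mul_of_isHomogeneous hu]
      have : (fun i => π (X 1) * ![π (X 0) / π (X 1), 1, π (X 2) / π (X 1)] i) =
          fun i => π (X i) := by
        funext i
        fin_cases i <;> simp [mul_div_cancel₀, hy]
      rw [this, ← comp_aeval_apply, aeval_X_left_apply]
    rw [← hπ, ← hπ, key ha, key hb, mul_div_mul_left _ _ (pow_ne_zero _ hy)]
    exact div_mem (aeval_mem_of_forall_mem _ _ hv a) (aeval_mem_of_forall_mem _ _ hv b)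
  · rw [IntermediateField.adjoin_simple_le_iff]
    exact ⟨1, X 0, X 1, isHomogeneous_X _ _, isHomogeneous_X _ _, hX, by rw [hπ, hπ]⟩

theorem isRational_curvePoly (hd : d = d₁ + d₂ + 1) : IsRational (curvePoly d d₁ d₂) := by
  have hprime : (Ideal.span {curvePoly d d₁ d₂}).IsPrime :=
    (Ideal.span_singleton_prime (irreducible_curvePoly hd).ne_zero).2
      (irreducible_curvePoly hd).prime
  refine ⟨hprime, ?_⟩
  obtain ⟨π, hπ⟩ : ∃ π : MvPolynomial (Fin 3) ℂ →ₐ[ℂ]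
      FractionRing (MvPolynomial (Fin 3) ℂ ⧸ Ideal.span {curvePoly d d₁ d₂}),
      ∀ a, π a = algebraMap _ _ (Ideal.Quotient.mk (Ideal.span {curvePoly d d₁ d₂}) a) :=
    ⟨(IsScalarTower.toAlgHom ℂ (MvPolynomial (Fin 3) ℂ ⧸ Ideal.span {curvePoly d d₁ d₂}) _).comp
      (Ideal.Quotient.mkₐ ℂ _), fun _ => rfl⟩
  have hπ0 : ∀ a, π a = 0 → aeval ![Polynomial.X, 1, -(Polynomial.X ^ d + Polynomial.X ^ d₁)] a =
      (0 : Polynomial ℂ) := by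
    intro a ha
    rw [hπ, map_eq_zero_iff _ (IsFractionRing.injective _ _), Ideal.Quotient.eq_zero_iff_mem,
      Ideal.mem_span_singleton] at ha
    obtain ⟨q, rfl⟩ := ha
    rw [map_mul, aeval_parametrization_curvePoly, zero_mul]
  have hy : π (X 1) ≠ 0 := fun h => by simpa using hπ0 _ h
  have hX : X 1 ∉ Ideal.span {curvePoly d d₁ d₂} := fun h => hy <| by
    rw [hπ, Ideal.Quotient.eq_zero_iff_mem.2 h, map_zero]
  have htr : Transcendental ℂ (π (X 0) / π (X 1)) := by
    refine transcendental_of_forall_ne_algebraMap fun c hc => ?_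
    rw [div_eq_iff hy] at hc
    -- If `x/y` were a constant `c`, then `x - c y` would vanish on the curve, but the
    -- parametrization sends it to `t - c ≠ 0`.
    have h := hπ0 (X 0 - C c * X 1) (by
      rw [map_sub, map_mul, ← algebraMap_eq, AlgHom.commutes, hc, sub_self])
    refine Polynomial.X_sub_C_ne_zero c ?_
    simpa [Polynomial.algebraMap_eq] using h
  exact ⟨(IntermediateField.equivOfEq
    (functionField_curvePoly_eq_adjoin π hπ hd hX hy)).trans
      (RatFunc.algEquivOfTranscendental _ htr).symm⟩

/-! ### Irreducibility of the local equation -/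

theorem exists_coeff_ne_zero_of_coeff_mul_ne_zero {k σ : Type*} [Field k] [DecidableEq σ]
    {g h : MvPowerSeries σ k} {i : σ} {N : ℕ}
    (hgh : MvPowerSeries.coeff (Finsupp.single i N) (g * h) ≠ 0) :
    ∃ p q, p + q = N ∧ MvPowerSeries.coeff (Finsupp.single i p) g ≠ 0 ∧
      MvPowerSeries.coeff (Finsupp.single i q) h ≠ 0 := by
  rw [MvPowerSeries.coeff_mul, Finsupp.antidiagonal_single, Finset.sum_map] at hgh
  obtain ⟨⟨p, q⟩, hpq, hne⟩ := Finset.exists_ne_zero_of_sum_ne_zero hgh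
  exact ⟨p, q, Finset.HasAntidiagonal.mem_antidiagonal.1 hpq, left_ne_zero_of_mul hne, right_ne_zero_of_mul hne⟩

/-- A power series whose Newton polygon is the segment from `(b, 0)` to `(0, a)`, with `a` and `b`
coprime, is irreducible. -/
theorem irreducible_of_newtonPolygon {k : Type*} [Field k] {a b : ℕ} (ha : 0 < a) (hb : 0 < b)
    (hab : a.Coprime b) {g : MvPowerSeries (Fin 2) k}
    (h0 : MvPowerSeries.coeff (Finsupp.single 0 b) g ≠ 0)
    (h1 : MvPowerSeries.coeff (Finsupp.single 1 a) g ≠ 0)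
    (hg : ((a * b : ℕ) : ℕ∞) ≤ g.weightedOrder ![a, b]) : Irreducible g := by
  have hpos : 0 < a * b := Nat.mul_pos ha hb
  refine ⟨fun hu => ?_, ?_⟩
  · rw [MvPowerSeries.isUnit_iff_constantCoeff, isUnit_iff_ne_zero] at hu
    have h := hg.trans (MvPowerSeries.weightedOrder_le ![a, b] (d := 0) hu)
    simp at h
    omega
  · intro h l hgl
    by_contra! hcon
    simp only [MvPowerSeries.isUnit_iff_constantCoeff, isUnit_iff_ne_zero, not_not] at hcon
    rw [hgl] at h0 h1 hg
    have hne : ∀ (u : MvPowerSeries (Fin 2) k) (i : Fin 2) (p : ℕ),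
        MvPowerSeries.constantCoeff u = 0 →
        MvPowerSeries.coeff (Finsupp.single i p) u ≠ 0 → p ≠ 0 := by
      rintro u i p hu hp rfl
      exact hp (by simpa using hu)
    -- The pure powers at the ends of the segment split between the factors. Weighted orders add up
    -- to at least `a * b`, so all the bounds below are equalities; hence `p * a = p' * b`, and `b ∣
    -- p` contradicts `0 < p < b`.
    obtain ⟨p, q, hpq, hp, hq⟩ := exists_coeff_ne_zero_of_coeff_mul_ne_zero h0
    obtain ⟨p', q', hpq', hp', hq'⟩ := exists_coeff_ne_zero_of_coeff_mul_ne_zero h1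
    have p0 := hne _ _ _ hcon.1 hp
    have q0 := hne _ _ _ hcon.2 hq
    rw [MvPowerSeries.weightedOrder_mul] at hg
    have b1 := MvPowerSeries.weightedOrder_le ![a, b] hp
    have b2 := MvPowerSeries.weightedOrder_le ![a, b] hq
    have b3 := MvPowerSeries.weightedOrder_le ![a, b] hp'
    have b4 := MvPowerSeries.weightedOrder_le ![a, b] hq'
    simp only [Finsupp.weight_single, Matrix.cons_val_zero, Matrix.cons_val_one,
      smul_eq_mul] at b1 b2 b3 b4
    obtain ⟨α, hα⟩ := ENat.ne_top_iff_exists.1 (ne_top_of_le_ne_top (ENat.natCast_ne_top _) b1)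
    obtain ⟨β, hβ⟩ := ENat.ne_top_iff_exists.1 (ne_top_of_le_ne_top (ENat.natCast_ne_top _) b2)
    rw [← hα] at b1 b3 hg
    rw [← hβ] at b2 b4 hg
    norm_cast at b1 b2 b3 b4 hg
    have e1 : p * a + q * a = a * b := by rw [← hpq]; ring
    have e2 : p' * b + q' * b = a * b := by rw [← hpq']; ring
    have e3 : p * a = p' * b := by omega
    have hdvd : b ∣ p := hab.symm.dvd_of_dvd_mul_right ⟨p', by rw [e3, mul_comm]⟩
    have := Nat.le_of_dvd (Nat.pos_of_ne_zero p0) hdvd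
    omega

theorem localEquation_curvePoly :
    localEquation (curvePoly d d₁ d₂) ![0, 0, 1] ![1, 0, 0] ![0, 1, 0] =
      X 0 ^ d + X 0 ^ d₁ * X 1 ^ (d₂ + 1) + X 1 ^ (d - 1) := by
  simp [localEquation, curvePoly]

theorem irreducible_localEquation_curvePoly (hd : d = d₁ + d₂ + 1) (h₁ : 2 ≤ d₁) (h₂ : d₁ ≤ d₂) :
    Irreducible (localEquation (curvePoly d d₁ d₂) ![0, 0, 1] ![1, 0, 0] ![0, 1, 0] :
      MvPowerSeries (Fin 2) ℂ) := by
  have hE : (localEquation (curvePoly d d₁ d₂) ![0, 0, 1] ![1, 0, 0] ![0, 1, 0] :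
      MvPowerSeries (Fin 2) ℂ) = MvPowerSeries.monomial (Finsupp.single 0 d) 1 +
        MvPowerSeries.monomial (Finsupp.single 0 d₁ + Finsupp.single 1 (d₂ + 1)) 1 +
        MvPowerSeries.monomial (Finsupp.single 1 (d - 1)) 1 := by
    rw [localEquation_curvePoly, X_pow_eq_monomial, X_pow_eq_monomial, X_pow_eq_monomial,
      X_pow_eq_monomial, monomial_mul, mul_one]
    simp only [coe_add, coe_monomial]
  have eval_ne : ∀ (m m' : Fin 2 →₀ ℕ) (i : Fin 2), m i ≠ m' i → m ≠ m' := by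
    rintro m _ i h rfl
    exact h rfl
  rw [hE]
  refine irreducible_of_newtonPolygon (a := d - 1) (b := d) (by omega) (by omega) ?_ ?_ ?_ ?_
  · have := Nat.coprime_self_add_right (m := d - 1) (n := 1)
    rwa [Nat.sub_add_cancel (by omega), iff_true_right (Nat.coprime_one_right _)] at this
  · rw [map_add, map_add, MvPowerSeries.coeff_monomial_same, MvPowerSeries.coeff_monomial_ne,
      MvPowerSeries.coeff_monomial_ne]
    · simp
    · exact eval_ne _ _ 0 (by simp; omega)
    · exact eval_ne _ _ 1 (by simp)
  · rw [map_add, map_add, MvPowerSeries.coeff_monomial_same, MvPowerSeries.coeff_monomial_ne,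
      MvPowerSeries.coeff_monomial_ne]
    · simp
    · exact eval_ne _ _ 0 (by simp; omega)
    · exact eval_ne _ _ 0 (by simp; omega)
  · refine MvPowerSeries.le_weightedOrder _ fun m hm => ?_
    have hm' : Finsupp.weight ![d - 1, d] m < (d - 1) * d := by exact_mod_cast hm
    rw [map_add, map_add, MvPowerSeries.coeff_monomial_ne, MvPowerSeries.coeff_monomial_ne,
      MvPowerSeries.coeff_monomial_ne, add_zero, add_zero]
    all_goals
      rintro rfl
      simp only [map_add, Finsupp.weight_single, Matrix.cons_val_zero, Matrix.cons_val_one,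
        smul_eq_mul] at hm'
    · exact lt_irrefl _ hm'
    -- The weight of the middle monomial exceeds `(d - 1) * d` by `d₂ + 1`.
    · obtain ⟨n, rfl⟩ : ∃ n, d = n + 1 := ⟨d - 1, by omega⟩
      rw [Nat.add_sub_cancel] at hm'
      have : d₁ + d₂ = n := by omega
      subst this
      nlinarith
    · rw [mul_comm] at hm'
      exact lt_irrefl _ hm'

/-! ### Puiseux parametrization of the branch -/

/-- The root of `b ^ n + t ^ e * b ^ e + 1` in `ℂ⟦t⟧` given by Hensel's lemma. -/
theorem exists_powerSeries_root {n e : ℕ} (he : 0 < e) (hen : e < n) :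
    ∃ b : PowerSeries ℂ, PowerSeries.constantCoeff b ≠ 0 ∧
      b ^ n + PowerSeries.X ^ e * b ^ e + 1 = 0 := by
  have hn : n ≠ 0 := by omega
  obtain ⟨c, hc⟩ := IsAlgClosed.exists_pow_nat_eq (-1 : ℂ) (Nat.pos_of_ne_zero hn)
  have hc0 : c ≠ 0 := by
    rintro rfl
    simp [hn] at hc
  obtain ⟨P, hP⟩ : ∃ P : Polynomial (PowerSeries ℂ), P = Polynomial.X ^ n +
    (Polynomial.C (PowerSeries.X ^ e) * Polynomial.X ^ e + 1) := ⟨_, rfl⟩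
  have hmonic : P.Monic := by
    rw [hP]
    refine Polynomial.monic_X_pow_add
      ((Polynomial.degree_add_le _ _).trans_lt (max_lt ?_ ?_))
    · exact (Polynomial.degree_C_mul_X_pow_le _ _).trans_lt (by exact_mod_cast hen)
    · rw [Polynomial.degree_one]
      exact_mod_cast Nat.pos_of_ne_zero hn
  have hmem : P.eval (PowerSeries.C c) ∈ Ideal.span {(PowerSeries.X : PowerSeries ℂ)} := by
    rw [Ideal.mem_span_singleton, PowerSeries.X_dvd_iff]
    simp [hP, hc, he.ne']
  -- Modulo `t` the polynomial is `Y^n + 1`, of which `c` is a simple root.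
  have hunit : IsUnit (Ideal.Quotient.mk (Ideal.span {(PowerSeries.X : PowerSeries ℂ)})
      (P.derivative.eval (PowerSeries.C c))) := by
    refine IsUnit.map _ (PowerSeries.isUnit_iff_constantCoeff.2 ?_)
    rw [hP, Polynomial.derivative_add, Polynomial.derivative_add, Polynomial.derivative_C_mul,
      Polynomial.derivative_X_pow, Polynomial.derivative_X_pow, Polynomial.derivative_one]
    simp [he.ne', hc0, hn]
  obtain ⟨b, hb, hbc⟩ := HenselianRing.is_henselian P hmonic _ hmem hunit
  refine ⟨b, ?_, ?_⟩
  · rw [Ideal.mem_span_singleton, PowerSeries.X_dvd_iff, map_sub, sub_eq_zero] at hbc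
    rw [hbc]
    simpa using hc0
  · simpa [hP, Polynomial.IsRoot.def, add_assoc] using hb

open Classical in
theorem gcdBelow_eq_of_forall_lt {n k : ℕ} {a : PowerSeries ℂ}
    (h : ∀ j < k, PowerSeries.coeff j a = 0) : gcdBelow n a k = n := by
  have : (Finset.range k).filter (fun j => PowerSeries.coeff j a ≠ 0) = ∅ := by
    simpa [Finset.filter_eq_empty_iff] using h
  simp [gcdBelow, this]

open Classical in
theorem gcdBelow_dvd {n k j : ℕ} {a : PowerSeries ℂ} (hj : j < k)
    (h : PowerSeries.coeff j a ≠ 0) : gcdBelow n a k ∣ Nat.gcd n j :=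
  Nat.gcd_dvd_gcd_of_dvd_right _ (Finset.gcd_dvd (f := id) (by simp [hj, h]))

theorem puiseuxPairs_eq_singleton {n k : ℕ} {a : PowerSeries ℂ} (hn : 1 < n) (hnk : n.Coprime k)
    (h0 : ∀ j < k, PowerSeries.coeff j a = 0) (hk : PowerSeries.coeff k a ≠ 0) :
    puiseuxPairs n a = {(n, k)} := by
  ext P
  simp only [puiseuxPairs, Set.mem_ofPred_eq, Set.mem_singleton_iff]
  constructor
  · rintro ⟨j, hj, hdvd, rfl⟩
    rcases lt_trichotomy j k with h | rfl | h
    · exact absurd (h0 j h) hj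
    · rw [gcdBelow_eq_of_forall_lt h0, hnk.gcd_eq_one, Nat.div_one, Nat.div_one]
    -- Past `k` the running gcd divides `gcd(n, k) = 1`, so no later exponent is characteristic.
    · have h1 := gcdBelow_dvd (n := n) h hk
      rw [hnk.gcd_eq_one] at h1
      exact absurd (h1.trans (one_dvd j)) hdvd
  · rintro rfl
    refine ⟨k, hk, ?_, ?_⟩ <;> rw [gcdBelow_eq_of_forall_lt h0]
    · intro h
      exact hn.ne' (Nat.eq_one_of_dvd_coprimes hnk dvd_rfl h)
    · rw [hnk.gcd_eq_one, Nat.div_one, Nat.div_one]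

theorem isFrameAt_standard (h : ![(0 : ℂ), 0, 1] ≠ 0) :
    IsFrameAt (Projectivization.mk ℂ ![(0 : ℂ), 0, 1] h) ![0, 0, 1] ![1, 0, 0] ![0, 1, 0] := by
  refine ⟨?_, h, rfl⟩
  rw [Fintype.linearIndependent_iff]
  intro g hg
  simp only [Fin.sum_univ_three] at hg
  have e0 := congrFun hg 0
  have e1 := congrFun hg 1
  have e2 := congrFun hg 2
  simp at e0 e1 e2
  intro i
  fin_cases i <;> assumption

theorem hasPuiseuxPairs_curvePoly (hd : d = d₁ + d₂ + 1) (h₁ : 2 ≤ d₁) (h₂ : d₁ ≤ d₂)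
    (h : ![(0 : ℂ), 0, 1] ≠ 0) :
    HasPuiseuxPairs (curvePoly d d₁ d₂) (Projectivization.mk ℂ ![(0 : ℂ), 0, 1] h)
      {(d - 1, d)} := by
  obtain ⟨b, hb0, hb⟩ := exists_powerSeries_root (n := d - 1) (e := d₂ + 1) (by omega) (by omega)
  have hcop : (d - 1).Coprime d := by
    have := Nat.coprime_self_add_right (m := d - 1) (n := 1)
    rwa [Nat.sub_add_cancel (by omega), iff_true_right (Nat.coprime_one_right _)] at this
  have hlt : ∀ j < d, PowerSeries.coeff j (PowerSeries.X ^ d * b) = 0 := fun j hj => by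
    rw [PowerSeries.coeff_X_pow_mul', if_neg (by omega)]
  have hcoeff : PowerSeries.coeff d (PowerSeries.X ^ d * b) ≠ 0 := by
    rw [PowerSeries.coeff_X_pow_mul', if_pos le_rfl, Nat.sub_self]
    simpa using hb0
  refine ⟨_, _, _, isFrameAt_standard h, irreducible_localEquation_curvePoly hd h₁ h₂,
    d - 1, PowerSeries.X ^ d * b, by omega, ?_, ?_, ?_, ?_⟩
  · exact PowerSeries.le_order _ _ fun i hi => hlt i (by
      have : i < d - 1 := by exact_mod_cast hi
      omega)
  · intro k hk hk'
    exact Nat.eq_one_of_dvd_coprimes hcop hk (hk' d hcoeff)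
  · rw [localEquation_curvePoly]
    simp only [map_add, map_mul, map_pow, aeval_X, Matrix.cons_val_zero, Matrix.cons_val_one]
    subst hd
    rw [Nat.add_sub_cancel] at hb ⊢
    -- Substituting `u = t^(d-1)`, `v = t^d b` gives `t^(d(d-1))` times `b^(d-1) + t^(d₂+1) b^(d₂+1)
    -- + 1`.
    linear_combination PowerSeries.X ^ ((d₁ + d₂) * (d₁ + d₂ + 1)) * hb
  · exact puiseuxPairs_eq_singleton (by omega) hcop hlt hcoeff

end PlaneCurve

theorem theorem1p1 (d d₁ d₂ : ℕ) (h₁ : 2 ≤ d₁) (h₂ : (d₁ : ℝ) < (d : ℝ) / 2)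
    (h₃ : d₂ = d - 1 - d₁) :
    (PlaneCurve.curvePoly d d₁ d₂).IsHomogeneous d ∧
    Irreducible (PlaneCurve.curvePoly d d₁ d₂) ∧
    PlaneCurve.IsFreeWithExponents (PlaneCurve.curvePoly d d₁ d₂) d₁ d₂ ∧
    PlaneCurve.IsRational (PlaneCurve.curvePoly d d₁ d₂) ∧
    ∃ p : Projectivization ℂ (Fin 3 → ℂ),
      (∀ q, PlaneCurve.IsSingularPoint (PlaneCurve.curvePoly d d₁ d₂) q ↔ q = p) ∧
      PlaneCurve.IsCusp (PlaneCurve.curvePoly d d₁ d₂) p ∧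
      PlaneCurve.HasPuiseuxPairs (PlaneCurve.curvePoly d d₁ d₂) p {(d - 1, d)} := by
  have h₄ : d₁ * 2 < d := by
    rw [lt_div_iff₀ two_pos] at h₂
    exact_mod_cast h₂
  have hd : d = d₁ + d₂ + 1 := by omega
  have hle : d₁ ≤ d₂ := by omega
  have hw : ![(0 : ℂ), 0, 1] ≠ 0 := fun h => by simpa using congrFun h 2
  have hsing : ∀ q, PlaneCurve.IsSingularPoint (PlaneCurve.curvePoly d d₁ d₂) q ↔
      q = Projectivization.mk ℂ ![(0 : ℂ), 0, 1] hw := fun q =>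
    (PlaneCurve.isSingularPoint_curvePoly_iff hd h₁ hle q).trans
      (PlaneCurve.rep_eq_zero_iff_eq_mk q hw)
  exact ⟨PlaneCurve.isHomogeneous_curvePoly hd, PlaneCurve.irreducible_curvePoly hd,
    PlaneCurve.isFreeWithExponents_curvePoly hd h₁ hle, PlaneCurve.isRational_curvePoly hd,
    _, hsing, ⟨(hsing _).2 rfl, _, _, _, PlaneCurve.isFrameAt_standard hw,
      PlaneCurve.irreducible_localEquation_curvePoly hd h₁ hle⟩,
    PlaneCurve.hasPuiseuxPairs_curvePoly hd h₁ hle hw⟩
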